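/- Let $T$ be a simplicial tree (every edge having length $1$), let $v_0$ be a vertex of $T$, and let $X$ be a finite subset of $\mathrm{Aut}(T)$ generating a group $G$. **Notation.** For $g\in\mathrm{Aut}(T)$ let $|g|=d(v_0,gv_0)$, and let $l(g)=\min_w d(w,gw)$, where $w$ ranges over the points of the geometric realisation of $T$. We call $g$ elliptic if $l(g)=0$ (so edge inversions are elliptic) and hyperbolic if $l(g)>0$; a group is purely hyperbolic if all its non-trivial elements are hyperbolic. Write $Y^{\pm}=Y\cup Y^{-1}$. A set $Y\subseteq\mathrm{Aut}(T)$ is N-reduced if it has no non-trivial elliptic element and - (N1) $Y\cap Y^{-1}=\varnothing$; - (N2) $|xy|\ge\max\{|x|,|y|\}$ for all $x,y\in Y^{\pm}$ with $x\ne y^{-1}$; - (N3) $|xyz|>|x|+|z|-|y|$ for all $x,y,z\in Y^{\pm}$ with $x\neq y^{-1}$ and $y\ne z^{-1}$. A Nielsen transformation of a set $Y$ is a finite composition of the following operations: remove some $g\in Y$ with $g^{-1}\in Y$ (where $g$ does not have order $2$); replace some $g\in Y$ by $g^{-1}$; replace some $g\in Y$ by $g^{\epsilon_1}h^{\epsilon_2}$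 or $h^{\epsilon_2}g^{\epsilon_1}$, where $h\in Y\setminus\{g\}$ and $\epsilon_1,\epsilon_2\in\{1,-1\}$. **Orderings.** Let $<$ be a well-ordering of the set of paths (without backtracking) of $T$ with initial vertex $v_0$ such that shorter paths precede longer ones and such that, for paths $p,q$ of equal length, $p<q$ whenever some initial subpath of $p$ precedes the initial subpath of $q$ of the same length. Let $H(g)$ be the initial subpath of $[v_0,gv_0]$ of length $\lfloor|g|/2\rfloor$. Define $g\le^\star h$ if $|g|<|h|$, or if $|g|=|h|$ and the unordered pair $\{H(g),H(g^{-1})\}$ precedes or equals $\{H(h),H(h^{-1})\}$; here the entries of a pair may coincide, and pairs are compared by their smaller entries first and then by their larger entries. Let $<^\star$ be the strict part of $\le^\star$. **Algorithm.** Start with $X'=X$ and repeat the following. 1. If $X'$ contains a non-trivial elliptic element, return $(\mathtt{False},X')$. 2. Otherwise, if there is $x\in X'\cap X'^{-1}$, replace $X'$ by $X'\setminus\{x\}$. 3. Otherwise, if there are $x,y\in X'^{\pm}$ with $x\ne y^{-1}$ and $xy<^\star x$, replace $X'$ by $(X'\setminus\{x,x^{-1}\})\cup\{xy\}$. 4.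 Otherwise, return $(\mathtt{True},X')$. **Theorem.** Well-orderings $<$ as above exist. For each of them, $\le^\star$ is a pre-well-ordering (a total pre-order with well-founded strict part) of $\mathrm{Aut}(T)$ and, whatever choices of $x$ and $y$ are made, the algorithm terminates on the input $X$ after finitely many iterations. Every output $(\mathit{flag},X')$ consists of a flag and a finite generating set $X'$ of $G$ obtained from $X$ by a Nielsen transformation. If the flag is $\mathtt{False}$, then $X'$ contains a non-trivial elliptic element. If the flag is $\mathtt{True}$, then $X'$ is N-reduced, $G$ is purely hyperbolic, and $X'$ is a free basis of $G$. -/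

import Mathlib

namespace TreeAut

variable {V : Type*}

/-! ### The geometric realisation of a graph, translation lengths, elliptic elements -/

/-- The geometric realisation of `T`, in barycentric coordinates: the union of all vertices and
all closed edges, the edge `uv` being the segment between the basis vectors of `u` and `v`. -/
def realisation (T : SimpleGraph V) : Set (V →₀ ℝ) :=
  {p | ∃ u v, (u = v ∨ T.Adj u v) ∧ p ∈ segment ℝ (Finsupp.single u (1 : ℝ)) (Finsupp.single v 1)}

/-- The lengths of the candidates for a shortest path between the points `p` and `q` of the
realisation, every edge having length `1`: a path inside one closed edge that contains both
points, or a path that goes straight from `p` to an end vertex `u` of its edge, then through the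
graph to an end vertex `v` of the edge of `q`, and straight on to `q`. -/
def pathLengths (T : SimpleGraph V) (p q : V →₀ ℝ) : Set ℝ :=
  {r | ∃ u v, (u = v ∨ T.Adj u v) ∧
      p ∈ segment ℝ (Finsupp.single u (1 : ℝ)) (Finsupp.single v 1) ∧
      q ∈ segment ℝ (Finsupp.single u (1 : ℝ)) (Finsupp.single v 1) ∧ r = |p u - q u|} ∪
  {r | ∃ u v, 0 < p u ∧ 0 < q v ∧ r = (1 - p u) + (T.dist u v : ℝ) + (1 - q v)}

/-- The path metric on the geometric realisation of a tree. -/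
noncomputable def realDist (T : SimpleGraph V) (p q : V →₀ ℝ) : ℝ :=
  sInf (pathLengths T p q)

/-- The translation length `l(g)`, the least displacement of a point of the realisation. -/
noncomputable def translationLength {T : SimpleGraph V} (g : T ≃g T) : ℝ :=
  sInf {r | ∃ p ∈ realisation T, r = realDist T p (Finsupp.mapDomain g p)}

def IsElliptic {T : SimpleGraph V} (g : T ≃g T) : Prop := translationLength g = 0

def IsHyperbolic {T : SimpleGraph V} (g : T ≃g T) : Prop := 0 < translationLength g

def PurelyHyperbolic {T : SimpleGraph V} (G : Subgroup (T ≃g T)) : Prop :=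
  ∀ g ∈ G, g ≠ 1 → IsHyperbolic g

/-! ### N-reduced sets, Nielsen transformations, free bases -/

/-- `|g| = d(v₀, g v₀)`. -/
noncomputable def len {T : SimpleGraph V} (v₀ : V) (g : T ≃g T) : ℕ := T.dist v₀ (g v₀)

/-- The set `X ∪ X⁻¹`. -/
def pm {A : Type*} [Group A] (X : Set A) : Set A := {g | g ∈ X ∨ g⁻¹ ∈ X}

structure NReduced {T : SimpleGraph V} (v₀ : V) (X : Set (T ≃g T)) : Prop where
  no_elliptic : ∀ x ∈ X, IsElliptic x → x = 1
  n1 : ∀ x ∈ X, x⁻¹ ∉ X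
  n2 : ∀ x ∈ pm X, ∀ y ∈ pm X, x ≠ y⁻¹ → max (len v₀ x) (len v₀ y) ≤ len v₀ (x * y)
  n3 : ∀ x ∈ pm X, ∀ y ∈ pm X, ∀ z ∈ pm X, x ≠ y⁻¹ → y ≠ z⁻¹ →
    (len v₀ x : ℤ) + len v₀ z - len v₀ y < len v₀ (x * y * z)

/-- The elementary Nielsen operations on subsets of a group. An element of order two may not be
removed. -/
inductive NielsenOp {A : Type*} [Group A] : Set A → Set A → Prop
  | remove {X : Set A} {g : A} (hg : g ∈ X) (hg' : g⁻¹ ∈ X) (h : g = g⁻¹ → g = 1) :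
      NielsenOp X (X \ {g})
  | invert {X : Set A} {g : A} (hg : g ∈ X) : NielsenOp X (X \ {g} ∪ {g⁻¹})
  | mul_right {X : Set A} {g h g' h' : A} (hg : g ∈ X) (hh : h ∈ X) (hne : h ≠ g)
      (hg' : g' = g ∨ g' = g⁻¹) (hh' : h' = h ∨ h' = h⁻¹) : NielsenOp X (X \ {g} ∪ {g' * h'})
  | mul_left {X : Set A} {g h g' h' : A} (hg : g ∈ X) (hh : h ∈ X) (hne : h ≠ g)
      (hg' : g' = g ∨ g' = g⁻¹) (hh' : h' = h ∨ h' = h⁻¹) : NielsenOp X (X \ {g} ∪ {h' * g'})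

/-- `Y` is obtained from `X` by a Nielsen transformation. -/
def NielsenTransforms {A : Type*} [Group A] (X Y : Set A) : Prop :=
  Relation.ReflTransGen NielsenOp X Y

/-- `X` is a free basis of the subgroup `G`. -/
def IsFreeBasis {A : Type*} [Group A] (X : Set A) (G : Subgroup A) : Prop :=
  ∃ b : FreeGroupBasis X G, ∀ x : X, (b x : A) = x

/-! ### Well-orderings of paths and the induced pre-ordering of automorphisms -/

/-- The paths (without backtracking) with initial vertex `v₀`. -/
abbrev RootedPath (T : SimpleGraph V) (v₀ : V) : Type _ := Σ v, T.Path v₀ v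

namespace RootedPath

variable {T : SimpleGraph V} {v₀ : V}

def length (p : RootedPath T v₀) : ℕ := p.2.1.length

/-- The initial subpath of `p` with `n` edges (all of `p` if there are fewer). -/
def take (p : RootedPath T v₀) (n : ℕ) : RootedPath T v₀ :=
  ⟨p.2.1.getVert n, p.2.1.take n, p.2.2.take n⟩

end RootedPath

/-- A length-first lexicographic well-ordering of the paths starting at `v₀`. -/
structure PathOrder (T : SimpleGraph V) (v₀ : V) where
  lt : RootedPath T v₀ → RootedPath T v₀ → Prop
  isWellOrder : IsWellOrder (RootedPath T v₀) lt
  lt_of_length : ∀ p q, p.length < q.length → lt p q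
  lt_of_take : ∀ p q n, p.length = q.length → lt (p.take n) (q.take n) → lt p q

section Order

variable {T : SimpleGraph V} {v₀ : V}

/-- The path `[v₀, w]`. -/
noncomputable def treePath (hT : T.IsTree) (v₀ w : V) : RootedPath T v₀ :=
  ⟨w, (hT.existsUnique_path v₀ w).choose, (hT.existsUnique_path v₀ w).choose_spec.1⟩

/-- The initial half `H(g)`: the initial subpath of `[v₀, g v₀]` of length `⌊|g| / 2⌋`. -/
noncomputable def half (hT : T.IsTree) (v₀ : V) (g : T ≃g T) : RootedPath T v₀ :=
  (treePath hT v₀ (g v₀)).take (len v₀ g / 2)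

open Classical in
/-- The smaller of two paths. -/
noncomputable def PathOrder.min (O : PathOrder T v₀) (p q : RootedPath T v₀) : RootedPath T v₀ :=
  if O.lt q p then q else p

open Classical in
/-- The larger of two paths. -/
noncomputable def PathOrder.max (O : PathOrder T v₀) (p q : RootedPath T v₀) : RootedPath T v₀ :=
  if O.lt q p then p else q

/-- The ordering `{p, q} ≺ {p', q'}` of unordered pairs: compare the smaller entries, then the
larger ones. For sets `A ≠ B` of two elements this says that the least element of
`(A ∪ B) \ (A ∩ B)` lies in `A`; a pair may also have two equal entries. -/
def PathOrder.pairLT (O : PathOrder T v₀) (p q p' q' : RootedPath T v₀) : Prop :=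
  O.lt (O.min p q) (O.min p' q') ∨ (O.min p q = O.min p' q' ∧ O.lt (O.max p q) (O.max p' q'))

/-- The pre-ordering `≤⋆`: compare `|g|` and `|h|` first, then the unordered pairs
`{H(g), H(g⁻¹)}` and `{H(h), H(h⁻¹)}`. -/
def PathOrder.starLE (O : PathOrder T v₀) (hT : T.IsTree) (g h : T ≃g T) : Prop :=
  len v₀ g < len v₀ h ∨ (len v₀ g = len v₀ h ∧
    (O.pairLT (half hT v₀ g) (half hT v₀ g⁻¹) (half hT v₀ h) (half hT v₀ h⁻¹) ∨
      s(half hT v₀ g, half hT v₀ g⁻¹) = s(half hT v₀ h, half hT v₀ h⁻¹)))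

/-- The strict part `<⋆` of `≤⋆`. -/
def PathOrder.starLT (O : PathOrder T v₀) (hT : T.IsTree) (g h : T ≃g T) : Prop :=
  O.starLE hT g h ∧ ¬ O.starLE hT h g

end Order

/-- `le` is a pre-well-ordering: a total pre-order whose strict part is well-founded. -/
structure IsPreWellOrdering {A : Type*} (le : A → A → Prop) : Prop where
  refl : ∀ a, le a a
  trans : ∀ a b c, le a b → le b c → le a c
  total : ∀ a b, le a b ∨ le b a
  wf : WellFounded fun a b => le a b ∧ ¬ le b a

/-! ### The reduction algorithm -/

/-- A state of the algorithm: at the head of the loop with the current value of the program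
variable, or halted with the returned flag and set. -/
inductive State (A : Type*)
  | loop (X : Set A)
  | ret (flag : Bool) (X : Set A)

section Algorithm

variable {T : SimpleGraph V} {v₀ : V}

/-- The first test: there is a non-trivial elliptic `x ∈ X`. -/
def HasElliptic (X : Set (T ≃g T)) : Prop := ∃ x ∈ X, x ≠ 1 ∧ IsElliptic x

/-- The second test: there is `x ∈ X ∩ X⁻¹`. -/
def HasInversePair (X : Set (T ≃g T)) : Prop := ∃ x ∈ X, x⁻¹ ∈ X

/-- `x, y` witness the third test: `x, y ∈ X ∪ X⁻¹`, `x ≠ y⁻¹` and `xy <⋆ x`. -/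
def Reduces (hT : T.IsTree) (O : PathOrder T v₀) (X : Set (T ≃g T)) (x y : T ≃g T) : Prop :=
  x ∈ pm X ∧ y ∈ pm X ∧ x ≠ y⁻¹ ∧ O.starLT hT (x * y) x

/-- One iteration of the loop. The witnesses of the tests may be chosen arbitrarily. -/
inductive Step (hT : T.IsTree) (O : PathOrder T v₀) : State (T ≃g T) → State (T ≃g T) → Prop
  | elliptic {X : Set (T ≃g T)} (h₁ : HasElliptic X) : Step hT O (.loop X) (.ret false X)
  | cancel {X : Set (T ≃g T)} {x : T ≃g T} (h₁ : ¬ HasElliptic X) (hx : x ∈ X) (hx' : x⁻¹ ∈ X) :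
      Step hT O (.loop X) (.loop (X \ {x}))
  | replace {X : Set (T ≃g T)} {x y : T ≃g T} (h₁ : ¬ HasElliptic X) (h₂ : ¬ HasInversePair X)
      (h₃ : Reduces hT O X x y) : Step hT O (.loop X) (.loop (X \ {x, x⁻¹} ∪ {x * y}))
  | done {X : Set (T ≃g T)} (h₁ : ¬ HasElliptic X) (h₂ : ¬ HasInversePair X)
      (h₃ : ¬ ∃ x y, Reduces hT O X x y) : Step hT O (.loop X) (.ret true X)

/-- No infinite sequence of iterations starts from the input `X`. -/
def Terminates (hT : T.IsTree) (O : PathOrder T v₀) (X : Set (T ≃g T)) : Prop :=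
  Acc (fun s' s => Step hT O s s') (.loop X)

/-- Some run of the algorithm on the input `X` returns `(flag, X')`. -/
def Returns (hT : T.IsTree) (O : PathOrder T v₀) (X : Set (T ≃g T)) (flag : Bool)
    (X' : Set (T ≃g T)) : Prop :=
  Relation.ReflTransGen (Step hT O) (.loop X) (.ret flag X')

end Algorithm

end TreeAut

/-! ### The metric of a tree -/

namespace SimpleGraph

variable {V : Type*} {T : SimpleGraph V}

/-! Termination: every iteration of the loop either deletes an element of the finite set or replaces
one by a `<⋆`-smaller element. Since `<⋆` is well-founded, so is the induced order on finite
multisets (`terminates`). Each iteration is a Nielsen operation. The delicate point is that `y` must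
not be `x` itself: `x * x <⋆ x` would give `|x²| ≤ |x|`, and then the middle of `[v₀, x v₀]` is
fixed, so `x` is elliptic (`isElliptic_of_len_sq_le`) and the first test would have stopped the run.

When no test applies, (N2) holds because a shorter product is `<⋆`-smaller. If (N3) failed for `x,
y, z`, the four point condition would give `|xy| = |x|` and `|yz| = |z|`, so exactly half of `y`
cancels on each side. With `m` the midpoint of `[v₀, y v₀]`, passing from `x` to `xy` trades the
path `[v₀, m]` for `[v₀, y⁻¹ m]`, and passing from `z⁻¹` to `z⁻¹y⁻¹` makes the opposite trade
(`PathOrder.starLT_mul_of_lt`). Neither is a decrease, so `y⁻¹ m = m` and `y` is elliptic, a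
contradiction (`nReduced_of_not_reduces`).

For an N-reduced set, (N3) says that the cancellations on the two sides of a letter never use it up.
Hence lengths of reduced words are computed from adjacent pairs (`NReduced.len_prod_cons_cons`) and
grow at least linearly in the number of letters. This gives freeness, and unbounded lengths of
powers, hence hyperbolicity. -/

theorem Connected.exists_adj_dist_eq (hT : T.Connected) {m c : V} (h : m ≠ c) :
    ∃ n, T.Adj m n ∧ T.dist m c = T.dist n c + 1 := by
  obtain ⟨p, hp⟩ := hT.exists_walk_length_eq_dist m c
  cases p with
  | nil => exact absurd rfl h
  | @cons _ n _ hadj q =>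
    refine ⟨n, hadj, le_antisymm ?_ ?_⟩
    · have := hT.dist_triangle (u := m) (v := n) (w := c)
      rw [dist_eq_one_iff_adj.2 hadj] at this
      omega
    · have := dist_le q
      simp only [Walk.length_cons] at hp
      omega

namespace IsTree

/-- Both neighbours are the penultimate vertex of the unique path from `b` to `w`. -/
theorem eq_of_adj_of_dist_lt (hT : T.IsTree) {b w u u' : V} (hu : T.Adj u w) (hu' : T.Adj u' w)
    (h : T.dist b u < T.dist b w) (h' : T.dist b u' < T.dist b w) : u = u' := by
  have key : ∀ u, T.Adj u w → T.dist b u < T.dist b w →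
      ∃ p : T.Walk b w, p.IsPath ∧ p.penultimate = u := by
    intro u hu h
    obtain ⟨p, hp, hl⟩ := hT.connected.exists_path_of_dist b u
    refine ⟨p.concat hu, ?_, by simp⟩
    refine hp.concat ?_ hu
    intro hw
    classical
    have h1 := dist_le (p.takeUntil w hw)
    have h2 := p.length_takeUntil_le_length hw
    omega
  obtain ⟨p, hp, rfl⟩ := key u hu h
  obtain ⟨q, hq, rfl⟩ := key u' hu' h'
  rw [Subtype.mk.inj <| (hT.isAcyclic.subsingleton_path b w).elim ⟨p, hp⟩ ⟨q, hq⟩]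

/-- A geodesic whose first step leads away from `u` never turns back: turning at `n` would give `n`
two neighbours closer to `u`, forcing the geodesic to return to `m`. -/
theorem dist_eq_add_of_adj (hT : T.IsTree) {u c : V} (k : ℕ) : ∀ {m n : V}, T.Adj m n →
    T.dist m c = T.dist n c + 1 → T.dist u n = T.dist u m + 1 → T.dist n c = k →
    T.dist u c = T.dist u m + T.dist m c := by
  induction k with
  | zero =>
    intro m n _ h1 h2 h3
    obtain rfl := hT.connected.dist_eq_zero_iff.1 h3
    omega
  | succ k ih =>
    intro m n hmn h1 h2 h3
    have hnc : n ≠ c := by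
      rintro rfl
      simp at h3
    obtain ⟨n', hn', h4⟩ := hT.connected.exists_adj_dist_eq hnc
    have h5 : T.dist u n' = T.dist u n + 1 := by
      rcases hT.dist_eq_dist_add_one_of_adj u hn' with h | h
      · obtain rfl := hT.eq_of_adj_of_dist_lt (b := u) hmn hn'.symm (by omega) (by omega)
        omega
      · exact h
    have := ih hn' h4 h5 (by omega)
    omega

/-- From any vertex, at least one of the two halves of a geodesic is traversed outwards. -/
theorem dist_eq_add_or (hT : T.IsTree) {a m c : V} (u : V)
    (h : T.dist a c = T.dist a m + T.dist m c) :
    T.dist u a = T.dist u m + T.dist m a ∨ T.dist u c = T.dist u m + T.dist m c := by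
  by_cases hma : m = a
  · subst hma; left; simp
  by_cases hmc : m = c
  · subst hmc; right; simp
  obtain ⟨n, hn, h1⟩ := hT.connected.exists_adj_dist_eq hmc
  obtain ⟨n', hn', h2⟩ := hT.connected.exists_adj_dist_eq hma
  rcases hT.dist_eq_dist_add_one_of_adj u hn with h3 | h3
  · rcases hT.dist_eq_dist_add_one_of_adj u hn' with h4 | h4
    · obtain rfl := hT.eq_of_adj_of_dist_lt (b := u) hn.symm hn'.symm (by omega) (by omega)
      have := hT.connected.dist_triangle (u := a) (v := n) (w := c)
      rw [dist_comm (u := m) (v := a), dist_comm (u := n) (v := a)] at h2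
      omega
    · exact .inl (hT.dist_eq_add_of_adj _ hn' h2 h4 rfl)
  · exact .inr (hT.dist_eq_add_of_adj _ hn h1 h3 rfl)

theorem exists_median (hT : T.IsTree) (a b c : V) : ∃ m, T.dist a c = T.dist a m + T.dist m c ∧
    T.dist b a = T.dist b m + T.dist m a ∧ T.dist b c = T.dist b m + T.dist m c := by
  -- The median is the vertex of `[a, c]` nearest to `b`; by minimality the steps from it towards
  -- `a` and `c` lead away from `b`.
  obtain ⟨m, hm, hmin⟩ := (measure (T.dist b)).wf.has_min
    {m | T.dist a c = T.dist a m + T.dist m c} ⟨a, by simp⟩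
  have hmin' : ∀ n, T.dist a c = T.dist a n + T.dist n c → T.dist b m ≤ T.dist b n :=
    fun n hn => not_lt.1 (hmin n hn)
  rw [Set.mem_ofPred_eq] at hm
  refine ⟨m, hm, ?_, ?_⟩
  · by_cases hma : m = a
    · subst hma; simp
    obtain ⟨n, hn, h2⟩ := hT.connected.exists_adj_dist_eq hma
    refine hT.dist_eq_add_of_adj _ hn h2 ?_ rfl
    have h3 := hT.connected.dist_triangle (u := a) (v := n) (w := c)
    have h4 := hT.connected.dist_triangle (u := n) (v := m) (w := c)
    rw [dist_comm (u := m) (v := a), dist_comm (u := n) (v := a)] at h2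
    rw [dist_eq_one_iff_adj.2 hn.symm] at h4
    have := hmin' n (by omega)
    rcases hT.dist_eq_dist_add_one_of_adj b hn with h | h <;> omega
  · by_cases hmc : m = c
    · subst hmc; simp
    obtain ⟨n, hn, h2⟩ := hT.connected.exists_adj_dist_eq hmc
    refine hT.dist_eq_add_of_adj _ hn h2 ?_ rfl
    have h3 := hT.connected.dist_triangle (u := a) (v := n) (w := c)
    have h4 := hT.connected.dist_triangle (u := a) (v := m) (w := n)
    rw [dist_eq_one_iff_adj.2 hn] at h4
    have := hmin' n (by omega)
    rcases hT.dist_eq_dist_add_one_of_adj b hn with h | h <;> omega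

/-- The four point condition: trees are `0`-hyperbolic. -/
theorem four_point (hT : T.IsTree) (a b c u : V) : T.dist a c + T.dist b u ≤
    max (T.dist a b + T.dist c u) (T.dist b c + T.dist a u) := by
  obtain ⟨m, h1, h2, h3⟩ := hT.exists_median a b c
  have h4 := hT.connected.dist_triangle (u := b) (v := m) (w := u)
  have h5 := T.dist_comm (u := a) (v := b)
  have h6 := T.dist_comm (u := a) (v := m)
  have h7 := T.dist_comm (u := a) (v := u)
  have h8 := T.dist_comm (u := c) (v := u)
  have h9 := T.dist_comm (u := m) (v := u)
  rcases hT.dist_eq_add_or u h1 with h | h <;> omega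

/-- The perimeter of a tripod is twice the sum of its legs. -/
theorem even_dist_add_dist_add_dist (hT : T.IsTree) (a b c : V) :
    Even (T.dist a b + T.dist b c + T.dist a c) := by
  obtain ⟨m, h1, h2, h3⟩ := hT.exists_median a b c
  have h5 := T.dist_comm (u := a) (v := b)
  have h6 := T.dist_comm (u := a) (v := m)
  exact ⟨T.dist a m + T.dist b m + T.dist m c, by omega⟩

theorem exists_dist_eq (hT : T.IsTree) (a b : V) (k : ℕ) : k ≤ T.dist a b →
    ∃ p, T.dist a p = k ∧ T.dist a b = k + T.dist p b := by
  induction k with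
  | zero => exact fun _ => ⟨a, by simp⟩
  | succ k ih =>
    intro hk
    obtain ⟨p, h1, h2⟩ := ih (by omega)
    have hpb : p ≠ b := by
      rintro rfl
      simp at h2
      omega
    obtain ⟨n, hn, h3⟩ := hT.connected.exists_adj_dist_eq hpb
    have h4 := hT.connected.dist_triangle (u := a) (v := p) (w := n)
    have h5 := hT.connected.dist_triangle (u := a) (v := n) (w := b)
    rw [dist_eq_one_iff_adj.2 hn] at h4
    exact ⟨n, by omega, by omega⟩

theorem eq_of_dist_eq (hT : T.IsTree) {a b p q : V} (hp : T.dist a b = T.dist a p + T.dist p b)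
    (hq : T.dist a b = T.dist a q + T.dist q b) (h : T.dist a p = T.dist a q) : p = q := by
  have := hT.four_point p a q b
  rw [T.dist_comm (u := p) (v := a)] at this
  exact hT.connected.dist_eq_zero_iff.1 (by omega)

end IsTree

theorem Iso.dist_apply (g : T ≃g T) (hT : T.Connected) (u v : V) :
    T.dist (g u) (g v) = T.dist u v := by
  have key : ∀ (g : T ≃g T) u v, T.dist (g u) (g v) ≤ T.dist u v := by
    intro g u v
    obtain ⟨p, hp⟩ := hT.exists_walk_length_eq_dist u v
    rw [← hp, ← p.length_map g.toHom]
    exact dist_le _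
  refine le_antisymm (key g u v) ?_
  simpa using key g.symm (g u) (g v)

end SimpleGraph

/-! ### Elliptic and hyperbolic automorphisms -/

namespace TreeAut

variable {V : Type*} {T : SimpleGraph V}

theorem exists_of_mem_segment_single {p : V →₀ ℝ} {u v : V}
    (hp : p ∈ segment ℝ (Finsupp.single u (1 : ℝ)) (Finsupp.single v 1)) :
    ∃ a b : ℝ, 0 ≤ a ∧ 0 ≤ b ∧ a + b = 1 ∧ p = Finsupp.single u a + Finsupp.single v b := by
  obtain ⟨a, b, ha, hb, hab, rfl⟩ := hp
  exact ⟨a, b, ha, hb, hab, by simp⟩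

theorem mapDomain_mem_segment (g : T ≃g T) {p : V →₀ ℝ} {u v : V}
    (hp : p ∈ segment ℝ (Finsupp.single u (1 : ℝ)) (Finsupp.single v 1)) :
    Finsupp.mapDomain g p ∈ segment ℝ (Finsupp.single (g u) (1 : ℝ)) (Finsupp.single (g v) 1) := by
  obtain ⟨a, b, ha, hb, hab, rfl⟩ := hp
  exact ⟨a, b, ha, hb, hab, by simp [Finsupp.mapDomain_add, Finsupp.mapDomain_single]⟩

theorem mapDomain_mem_realisation (g : T ≃g T) {p : V →₀ ℝ} (hp : p ∈ realisation T) :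
    Finsupp.mapDomain g p ∈ realisation T := by
  obtain ⟨u, v, h, hp⟩ := hp
  exact ⟨g u, g v, h.imp (congrArg g) g.map_adj_iff.2, mapDomain_mem_segment g hp⟩

theorem apply_le_one {p : V →₀ ℝ} (hp : p ∈ realisation T) (x : V) : p x ≤ 1 := by
  classical
  obtain ⟨u, v, -, hp⟩ := hp
  obtain ⟨a, b, ha, hb, hab, rfl⟩ := exists_of_mem_segment_single hp
  simp only [Finsupp.add_apply, Finsupp.single_apply]
  split_ifs <;> linarith

theorem apply_add_apply_le_one {p : V →₀ ℝ} (hp : p ∈ realisation T) {x y : V} (hxy : x ≠ y) :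
    p x + p y ≤ 1 := by
  classical
  obtain ⟨u, v, -, hp⟩ := hp
  obtain ⟨a, b, ha, hb, hab, rfl⟩ := exists_of_mem_segment_single hp
  simp only [Finsupp.add_apply, Finsupp.single_apply]
  split_ifs <;> first | linarith | (subst_vars; exact absurd rfl hxy)

theorem exists_apply_pos {p : V →₀ ℝ} (hp : p ∈ realisation T) : ∃ x, 0 < p x := by
  classical
  obtain ⟨u, v, -, hp⟩ := hp
  obtain ⟨a, b, ha, hb, hab, rfl⟩ := exists_of_mem_segment_single hp
  by_cases h : 0 < a
  · refine ⟨u, ?_⟩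
    simp only [Finsupp.add_apply, Finsupp.single_apply]
    split_ifs <;> linarith
  · refine ⟨v, ?_⟩
    simp only [Finsupp.add_apply, Finsupp.single_apply]
    split_ifs <;> linarith

theorem eq_or_eq_of_mem_segment {p : V →₀ ℝ} {u v x : V}
    (hp : p ∈ segment ℝ (Finsupp.single u (1 : ℝ)) (Finsupp.single v 1)) (hx : p x ≠ 0) :
    x = u ∨ x = v := by
  classical
  obtain ⟨a, b, -, -, -, rfl⟩ := exists_of_mem_segment_single hp
  by_contra! h
  simp [h.1, h.2] at hx

theorem nonneg_of_mem_pathLengths {p q : V →₀ ℝ} (hp : p ∈ realisation T) (hq : q ∈ realisation T)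
    {r : ℝ} (hr : r ∈ pathLengths T p q) : 0 ≤ r := by
  rcases hr with ⟨u, v, -, -, -, rfl⟩ | ⟨u, v, -, -, rfl⟩
  · positivity
  · have := apply_le_one hp u
    have := apply_le_one hq v
    have : (0 : ℝ) ≤ T.dist u v := by positivity
    linarith

theorem isElliptic_of_mapDomain_eq {g : T ≃g T} {p : V →₀ ℝ} (hp : p ∈ realisation T)
    (h : Finsupp.mapDomain g p = p) : IsElliptic g := by
  refine IsLeast.csInf_eq ⟨⟨p, hp, ?_⟩, ?_⟩
  · rw [h]
    refine (IsLeast.csInf_eq ⟨.inl ?_, fun r hr => nonneg_of_mem_pathLengths hp hp hr⟩).symm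
    obtain ⟨u, v, huv, hp⟩ := hp
    exact ⟨u, v, huv, hp, hp, by simp⟩
  · rintro r ⟨q, hq, rfl⟩
    exact Real.sInf_nonneg fun r hr =>
      nonneg_of_mem_pathLengths hq (mapDomain_mem_realisation g hq) hr

theorem isElliptic_of_fixed {g : T ≃g T} {u : V} (h : g u = u) : IsElliptic g :=
  isElliptic_of_mapDomain_eq (p := Finsupp.single u 1) ⟨u, u, .inl rfl, by simp⟩
    (by simp [Finsupp.mapDomain_single, h])

theorem isElliptic_of_inverted {g : T ≃g T} {u : V} (hadj : T.Adj u (g u)) (h : g (g u) = u) :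
    IsElliptic g := by
  refine isElliptic_of_mapDomain_eq
    (p := Finsupp.single u (1 / 2 : ℝ) + Finsupp.single (g u) (1 / 2 : ℝ))
    ⟨u, g u, .inr hadj, 1 / 2, 1 / 2, by norm_num, by norm_num, by norm_num, by simp⟩ ?_
  simp [Finsupp.mapDomain_add, Finsupp.mapDomain_single, h, add_comm]

/-- Without fixed vertices and inversions, `p` and its image share a closed edge only if `p` is an
end of it. Otherwise, for a path leaving through `u` and arriving through `g x`, either `u = x` and
`u` is moved by at least `1`, or the two end segments already add up to `2 - (p u + p x) ≥ 1`. -/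
theorem one_le_of_mem_pathLengths (hT : T.Connected) {g : T ≃g T} (h : ∀ u, g u ≠ u)
    (h' : ∀ u, T.Adj u (g u) → g (g u) ≠ u) {p : V →₀ ℝ} (hp : p ∈ realisation T) {r : ℝ}
    (hr : r ∈ pathLengths T p (Finsupp.mapDomain g p)) : 1 ≤ r := by
  classical
  have hq : ∀ x, Finsupp.mapDomain g p (g x) = p x :=
    fun x => Finsupp.mapDomain_apply g.injective p x
  rcases hr with ⟨u, v, huv, hpuv, hquv, rfl⟩ | ⟨u, v, -, -, rfl⟩
  · obtain ⟨a, b, ha, hb, hab, rfl⟩ := exists_of_mem_segment_single hpuv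
    have huv' : u ≠ v := by
      rintro rfl
      have := eq_or_eq_of_mem_segment (x := g u) hquv (by rw [hq]; simp [hab])
      simp [h] at this
    have hadj := huv.resolve_left huv'
    have hgu : a ≠ 0 → g u = v := fun ha =>
      (eq_or_eq_of_mem_segment hquv (by rw [hq]; simpa [huv'.symm] using ha)).resolve_left (h u)
    have hgv : b ≠ 0 → g v = u := fun hb =>
      (eq_or_eq_of_mem_segment hquv (by rw [hq]; simpa [huv'] using hb)).resolve_right (h v)
    by_cases ha0 : a = 0
    · have hgv' := hgv (by rintro rfl; simp [ha0] at hab)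
      have hqu := hq v
      rw [hgv'] at hqu
      rw [hqu]
      obtain rfl : b = 1 := by linarith
      simp [ha0, huv']
    by_cases hb0 : b = 0
    · have hgu' := hgu ha0
      obtain rfl : a = 1 := by linarith
      have : g v ≠ u := fun hvu => h' u (hgu' ▸ hadj) (hgu'.symm ▸ hvu)
      simp [Finsupp.mapDomain_single, hb0, hgu', huv'.symm]
    · exact absurd (by rw [hgu ha0, hgv hb0]) (h' u (by rwa [hgu ha0]))
  · obtain ⟨x, rfl⟩ := g.surjective v
    rw [hq]
    have h1 := apply_le_one hp x
    have h2 : (0 : ℝ) ≤ T.dist u (g x) := by positivity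
    by_cases hux : u = x
    · subst hux
      have : (1 : ℝ) ≤ T.dist u (g u) := by
        exact_mod_cast hT.pos_dist_of_ne (h u).symm
      linarith
    · have := apply_add_apply_le_one hp hux
      linarith

theorem isHyperbolic_of_forall (hT : T.Connected) {g : T ≃g T} (h : ∀ u, g u ≠ u)
    (h' : ∀ u, T.Adj u (g u) → g (g u) ≠ u) : IsHyperbolic g := by
  refine lt_of_lt_of_le one_pos (le_csInf ?_ ?_)
  · obtain ⟨u⟩ := hT.nonempty
    exact ⟨_, Finsupp.single u 1, ⟨u, u, .inl rfl, by simp⟩, rfl⟩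
  · rintro r ⟨p, hp, rfl⟩
    refine le_csInf ?_ fun r hr => one_le_of_mem_pathLengths hT h h' hp hr
    obtain ⟨x, hx⟩ := exists_apply_pos hp
    exact ⟨_, .inr ⟨x, g x, hx, by rwa [Finsupp.mapDomain_apply g.injective], rfl⟩⟩

/-! ### Displacement of the base vertex. -/

variable {v₀ : V}

theorem len_inv (hT : T.Connected) (g : T ≃g T) : len v₀ g⁻¹ = len v₀ g := by
  rw [len, len, ← g.dist_apply hT, RelIso.apply_inv_self, SimpleGraph.dist_comm]

theorem len_mul (hT : T.Connected) (g h : T ≃g T) : len v₀ (g * h) = T.dist (g⁻¹ v₀) (h v₀) := by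
  rw [len, ← g.dist_apply hT (g⁻¹ v₀), RelIso.apply_inv_self, RelIso.mul_apply]

theorem isElliptic_of_len_eq_zero (hT : T.Connected) {g : T ≃g T} (h : len v₀ g = 0) :
    IsElliptic g :=
  isElliptic_of_fixed (hT.dist_eq_zero_iff.1 h).symm

/-- The segments from `g v₀` to `v₀` and to `g (g v₀)` share at least half their length, so `g`
reflects the middle of `[v₀, g v₀]`: it fixes a central vertex or inverts a central edge. -/
theorem isElliptic_of_len_sq_le (hT : T.IsTree) {g : T ≃g T} (h : len v₀ (g * g) ≤ len v₀ g) :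
    IsElliptic g := by
  have h0 := g.dist_apply hT.connected
  rw [len, len, RelIso.mul_apply] at h
  -- The `+ 1` admits the farther end of the central edge when `|g|` is odd; it is available because
  -- `|g²|` is even by parity of perimeters, so that `|g²| ≤ |g| - 1`.
  have key : ∀ p q, T.dist v₀ (g v₀) = T.dist v₀ p + T.dist p (g v₀) →
      T.dist v₀ (g v₀) = T.dist v₀ q + T.dist q (g v₀) → T.dist q (g v₀) = T.dist v₀ p →
      2 * T.dist v₀ p ≤ T.dist v₀ (g v₀) + 1 → g p = q := by
    intro p q hp hq hpq hle
    have h1 := h0 v₀ (g v₀)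
    have h2 := h0 v₀ p
    have h3 := h0 p (g v₀)
    obtain ⟨j, h4⟩ := hT.even_dist_add_dist_add_dist v₀ (g v₀) (g (g v₀))
    have h5 := hT.connected.dist_triangle (u := g v₀) (v := q) (w := g (g v₀))
    have h6 := T.dist_comm (u := g v₀) (v := q)
    have h7 := T.dist_comm (u := g (g v₀)) (v := q)
    have h8 := T.dist_comm (u := g (g v₀)) (v := v₀)
    have h9 := T.dist_comm (u := q) (v := v₀)
    have h10 := T.dist_comm (u := g (g v₀)) (v := g v₀)
    refine hT.eq_of_dist_eq (a := g v₀) (b := g (g v₀)) (by omega) ?_ (by omega)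
    rcases hT.dist_eq_add_or (g (g v₀)) hq with h11 | h11 <;> omega
  obtain ⟨p, hp1, hp2⟩ := hT.exists_dist_eq v₀ (g v₀) (T.dist v₀ (g v₀) / 2) (by omega)
  rcases Nat.even_or_odd' (T.dist v₀ (g v₀)) with ⟨k, hk | hk⟩
  · exact isElliptic_of_fixed (key p p (by omega) (by omega) (by omega) (by omega))
  · have hpg : p ≠ g v₀ := by
      rintro rfl
      omega
    obtain ⟨q, hq, hq'⟩ := hT.connected.exists_adj_dist_eq hpg
    have h1 := hT.connected.dist_triangle (u := v₀) (v := p) (w := q)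
    have h2 := hT.connected.dist_triangle (u := v₀) (v := q) (w := g v₀)
    rw [SimpleGraph.dist_eq_one_iff_adj.2 hq] at h1
    have hgp := key p q (by omega) (by omega) (by omega) (by omega)
    have hgq := key q p (by omega) (by omega) (by omega) (by omega)
    exact isElliptic_of_inverted (u := p) (hgp ▸ hq) (by rw [hgp, hgq])

end TreeAut

/-! ### Well-orderings of paths -/

namespace List

variable {α : Type*} {r : α → α → Prop}

theorem Lex.of_take {s t : List α} (n : ℕ) (hlen : s.length = t.length)
    (h : List.Lex r (s.take n) (t.take n)) : List.Lex r s t := by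
  induction n generalizing s t with
  | zero => simp at h
  | succ n ih =>
    cases s with
    | nil =>
      cases t with
      | nil => simp at h
      | cons b t => simp at hlen
    | cons a s =>
      cases t with
      | nil => simp at hlen
      | cons b t =>
        simp only [List.take_succ_cons] at h
        cases h with
        | rel h => exact .rel h
        | cons h => exact .cons (ih (by simpa using hlen) h)

end List

namespace TreeAut

variable {V : Type*} {T : SimpleGraph V} {v₀ : V}

namespace RootedPath

theorem support_injective :
    Function.Injective fun p : RootedPath T v₀ => p.2.1.support := by
  rintro ⟨u, p⟩ ⟨v, q⟩ h
  obtain rfl : u = v := by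
    have h1 := p.1.getLast_support
    have h2 := q.1.getLast_support
    simp only at h
    simp_rw [← h1, h, h2]
  exact congrArg _ (Subtype.ext (SimpleGraph.Walk.ext_support h))

theorem length_eq_dist (hT : T.IsTree) (p : RootedPath T v₀) : p.length = T.dist v₀ p.1 := by
  obtain ⟨q, hq, hl⟩ := hT.connected.exists_path_of_dist v₀ p.1
  rw [← hl, length, Subtype.mk.inj <| (hT.isAcyclic.subsingleton_path v₀ p.1).elim p.2 ⟨q, hq⟩]

theorem eq_of_fst_eq (hT : T.IsTree) {p q : RootedPath T v₀} (h : p.1 = q.1) : p = q := by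
  obtain ⟨u, p⟩ := p
  obtain ⟨v, q⟩ := q
  obtain rfl : u = v := h
  exact congrArg _ ((hT.isAcyclic.subsingleton_path v₀ u).elim p q)

theorem take_length (p : RootedPath T v₀) (n : ℕ) : (p.take n).length = min n p.length :=
  p.2.1.take_length n

theorem dist_take_fst (hT : T.IsTree) (p : RootedPath T v₀) {n : ℕ} (hn : n ≤ p.length) :
    T.dist v₀ (p.take n).1 = n ∧ T.dist v₀ p.1 = n + T.dist (p.take n).1 p.1 := by
  have h1 := length_eq_dist hT (p.take n)
  rw [take_length] at h1
  have h2 := length_eq_dist hT p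
  have h3 := hT.connected.dist_triangle (u := v₀) (v := (p.take n).1) (w := p.1)
  have h4 := SimpleGraph.dist_le (p.2.1.drop n)
  rw [SimpleGraph.Walk.drop_length] at h4
  simp only [take] at *
  simp only [length] at *
  omega

end RootedPath

/-- Well-order the vertices and compare the vertex sequences of paths by the shortlex order. -/
theorem nonempty_pathOrder (T : SimpleGraph V) (v₀ : V) : Nonempty (PathOrder T v₀) := by
  let r : V → V → Prop := WellOrderingRel
  have hr : IsWellOrder V r := WellOrderingRel.isWellOrder
  refine ⟨⟨fun p q => List.Shortlex r p.2.1.support q.2.1.support, ?_, ?_, ?_⟩⟩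
  · have hwf : WellFounded fun p q : RootedPath T v₀ =>
        List.Shortlex r p.2.1.support q.2.1.support :=
      InvImage.wf (r := List.Shortlex r) _ (List.Shortlex.wf hr.wf)
    refine { toTrichotomous := ⟨?_⟩, wf := hwf }
    intro p q h1 h2
    exact RootedPath.support_injective (Std.Trichotomous.trichotomous _ _ h1 h2)
  · intro p q h
    exact .of_length_lt (by simpa [RootedPath.length] using h)
  · intro p q n hlen h
    simp only [RootedPath.take, SimpleGraph.Walk.support_take] at h
    have hlen' : p.2.1.support.length = q.2.1.support.length := by
      simpa [RootedPath.length] using hlen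
    rw [List.shortlex_iff_lex (by simp [hlen'])] at h
    exact .of_lex hlen' (h.of_take _ hlen')

/-! ### Initial subpaths and halves of geodesics. -/

theorem treePath_fst (hT : T.IsTree) (w : V) : (treePath hT v₀ w).1 = w := rfl

theorem treePath_length (hT : T.IsTree) (w : V) :
    (treePath hT v₀ w).length = T.dist v₀ w :=
  RootedPath.length_eq_dist hT _

/-- The initial subpath of `[v₀, w]` that ends in a given vertex of `[v₀, w]`. -/
theorem treePath_take (hT : T.IsTree) {w p : V} {n : ℕ} (hn : T.dist v₀ p = n)
    (hp : T.dist v₀ w = n + T.dist p w) : (treePath hT v₀ w).take n = treePath hT v₀ p := by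
  obtain ⟨h1, h2⟩ := RootedPath.dist_take_fst hT (treePath hT v₀ w) (n := n)
    (by rw [treePath_length]; omega)
  refine RootedPath.eq_of_fst_eq hT (hT.eq_of_dist_eq (a := v₀) (b := w) ?_ ?_ ?_)
  · rw [h1]; exact h2
  · rw [treePath_fst, hn]; exact hp
  · rw [h1, treePath_fst, hn]

theorem half_length (hT : T.IsTree) (g : T ≃g T) : (half hT v₀ g).length = len v₀ g / 2 := by
  rw [half, RootedPath.take_length, treePath_length, len]
  omega

/-- Short initial subpaths of `H(g)`. -/
theorem half_take (hT : T.IsTree) {g : T ≃g T} {p : V} {n : ℕ} (hn : T.dist v₀ p = n)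
    (hp : T.dist v₀ (g v₀) = n + T.dist p (g v₀)) (hle : n ≤ len v₀ g / 2) :
    (half hT v₀ g).take n = treePath hT v₀ p := by
  have hlen := half_length hT (v₀ := v₀) g
  obtain ⟨h1, h2⟩ := RootedPath.dist_take_fst hT (half hT v₀ g) (n := n) (by omega)
  obtain ⟨h3, h4⟩ := RootedPath.dist_take_fst hT (treePath hT v₀ (g v₀)) (n := len v₀ g / 2)
    (by rw [treePath_length, len]; omega)
  change T.dist v₀ (half hT v₀ g).1 = _ at h3
  change T.dist v₀ (g v₀) = _ + T.dist (half hT v₀ g).1 (g v₀) at h4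
  refine RootedPath.eq_of_fst_eq hT (hT.eq_of_dist_eq (a := v₀) (b := g v₀) ?_ ?_ ?_)
  · have h5 := hT.connected.dist_triangle (u := v₀) (v := ((half hT v₀ g).take n).1) (w := g v₀)
    have h6 := hT.connected.dist_triangle (u := ((half hT v₀ g).take n).1) (v := (half hT v₀ g).1)
      (w := g v₀)
    omega
  · rw [treePath_fst, hn]; exact hp
  · rw [h1, treePath_fst, hn]

/-- If `p` is a vertex of both `[v₀, g v₀]` and `[v₀, h v₀]` in the second half of both paths, then
`H(g) = H(h)`. -/
theorem half_eq_half (hT : T.IsTree) {g h : T ≃g T} {p : V} (hlen : len v₀ g = len v₀ h)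
    (hg : T.dist v₀ (g v₀) = T.dist v₀ p + T.dist p (g v₀))
    (hh : T.dist v₀ (h v₀) = T.dist v₀ p + T.dist p (h v₀)) (hle : len v₀ g / 2 ≤ T.dist v₀ p) :
    half hT v₀ g = half hT v₀ h := by
  obtain ⟨q, h1, h2⟩ := hT.exists_dist_eq v₀ p _ hle
  have h3 := hT.connected.dist_triangle (u := v₀) (v := q) (w := g v₀)
  have h4 := hT.connected.dist_triangle (u := q) (v := p) (w := g v₀)
  have h5 := hT.connected.dist_triangle (u := v₀) (v := q) (w := h v₀)
  have h6 := hT.connected.dist_triangle (u := q) (v := p) (w := h v₀)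
  rw [half, half, treePath_take hT h1 (by omega), ← hlen, treePath_take hT h1 (by omega)]

/-! ### The pre-ordering as a lexicographic order on ranks. -/

namespace PathOrder

variable (O : PathOrder T v₀)

/-- The linear order on paths given by a path order. -/
noncomputable abbrev linearOrder : LinearOrder (RootedPath T v₀) :=
  haveI := O.isWellOrder
  haveI := Classical.decRel O.lt
  linearOrderOfSTO O.lt

theorem min_eq (p q : RootedPath T v₀) :
    O.min p q = @Min.min _ O.linearOrder.toMin p q := by
  let := O.linearOrder
  by_cases h : O.lt q p
  · rw [PathOrder.min, if_pos h]
    exact (min_eq_right (le_of_lt (α := RootedPath T v₀) h)).symm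
  · rw [PathOrder.min, if_neg h]
    exact (min_eq_left (le_of_not_gt (α := RootedPath T v₀) h)).symm

theorem max_eq (p q : RootedPath T v₀) :
    O.max p q = @Max.max _ O.linearOrder.toMax p q := by
  let := O.linearOrder
  by_cases h : O.lt q p
  · rw [PathOrder.max, if_pos h]
    exact (max_eq_left (le_of_lt (α := RootedPath T v₀) h)).symm
  · rw [PathOrder.max, if_neg h]
    exact (max_eq_right (le_of_not_gt (α := RootedPath T v₀) h)).symm

theorem sym2_eq_iff (p q p' q' : RootedPath T v₀) :
    s(p, q) = s(p', q') ↔ O.min p q = O.min p' q' ∧ O.max p q = O.max p' q' := by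
  simp only [min_eq, max_eq]
  let := O.linearOrder
  rw [Sym2.eq_iff]
  constructor
  · rintro (⟨rfl, rfl⟩ | ⟨rfl, rfl⟩)
    · simp
    · exact ⟨min_comm _ _, max_comm _ _⟩
  · rintro ⟨h1, h2⟩
    rcases le_total p q with h | h <;> rcases le_total p' q' with h' | h' <;>
      simp [h, h'] at h1 h2 <;> simp [h1, h2]

theorem pairLT_of_lt {p q q' : RootedPath T v₀} (h : O.lt q q') : O.pairLT p q p q' := by
  simp only [pairLT, min_eq, max_eq]
  let := O.linearOrder
  change q < q' at h
  change Min.min p q < Min.min p q' ∨ Min.min p q = Min.min p q' ∧ Max.max p q < Max.max p q'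
  rcases le_total p q with h1 | h1
  · have := h1.trans h.le
    simp [*]
  · rcases h1.lt_or_eq with h1 | rfl
    · left
      simp [*, h1.le]
    · right
      simp [h, h.le]

/-- The rank of an automorphism: `≤⋆` is the pull-back of the lexicographic order. -/
noncomputable def rank (hT : T.IsTree) (g : T ≃g T) :
    ℕ × RootedPath T v₀ × RootedPath T v₀ :=
  (len v₀ g, O.min (half hT v₀ g) (half hT v₀ g⁻¹), O.max (half hT v₀ g) (half hT v₀ g⁻¹))

/-- The lexicographic order on ranks. -/
def rankLT : ℕ × RootedPath T v₀ × RootedPath T v₀ → ℕ × RootedPath T v₀ × RootedPath T v₀ → Prop :=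
  Prod.Lex (· < ·) (Prod.Lex O.lt O.lt)

instance : IsWellOrder _ O.rankLT :=
  haveI := O.isWellOrder
  inferInstanceAs (IsWellOrder _ (Prod.Lex _ _))

theorem starLE_iff (hT : T.IsTree) (g h : T ≃g T) :
    O.starLE hT g h ↔ O.rankLT (O.rank hT g) (O.rank hT h) ∨ O.rank hT g = O.rank hT h := by
  rw [starLE, O.sym2_eq_iff, rankLT, Prod.lex_def, Prod.lex_def, pairLT, rank, rank]
  simp only [Prod.mk.injEq]
  tauto

theorem starLT_iff (hT : T.IsTree) (g h : T ≃g T) :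
    O.starLT hT g h ↔ O.rankLT (O.rank hT g) (O.rank hT h) := by
  rw [starLT, O.starLE_iff, O.starLE_iff]
  constructor
  · rintro ⟨h1 | h1, h2⟩
    · exact h1
    · exact absurd (.inr h1.symm) h2
  · refine fun h1 => ⟨.inl h1, ?_⟩
    rintro (h2 | h2)
    · exact asymm h1 h2
    · exact irrefl _ (h2 ▸ h1)

theorem isPreWellOrdering_starLE (hT : T.IsTree) : IsPreWellOrdering (O.starLE hT) where
  refl a := (O.starLE_iff hT a a).2 (.inr rfl)
  trans a b c := by
    simp only [O.starLE_iff]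
    rintro (h1 | h1) (h2 | h2)
    · exact .inl (_root_.trans h1 h2)
    · exact .inl (h2 ▸ h1)
    · exact .inl (h1 ▸ h2)
    · exact .inr (h1.trans h2)
  total a b := by
    simp only [O.starLE_iff]
    rcases trichotomous_of O.rankLT (O.rank hT a) (O.rank hT b) with h | h | h
    · exact .inl (.inl h)
    · exact .inl (.inr h)
    · exact .inr (.inl h)
  wf := by
    have : (fun a b => O.starLE hT a b ∧ ¬ O.starLE hT b a) =
        InvImage O.rankLT (O.rank hT) := by
      ext a b
      exact O.starLT_iff hT a b
    rw [this]
    exact InvImage.wf _ IsWellFounded.wf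

/-- The pair of halves is unordered precisely for this: a reduction of `x = g⁻¹` is then also a
decrease from the stored element `g`. -/
theorem rank_inv (hT : T.IsTree) (g : T ≃g T) : O.rank hT g⁻¹ = O.rank hT g := by
  obtain ⟨h1, h2⟩ := (O.sym2_eq_iff _ _ _ _).1 (Sym2.eq_swap (a := half hT v₀ g⁻¹)
    (b := half hT v₀ g))
  rw [rank, rank, inv_inv, len_inv hT.connected, h1, h2]

theorem starLT_of_len_lt (hT : T.IsTree) {g h : T ≃g T} (hlt : len v₀ g < len v₀ h) :
    O.starLT hT g h :=
  (O.starLT_iff hT g h).2 (.left _ _ hlt)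

theorem starLT_of_pairLT (hT : T.IsTree) {g h : T ≃g T} (hlen : len v₀ g = len v₀ h)
    (hlt : O.pairLT (half hT v₀ g) (half hT v₀ g⁻¹) (half hT v₀ h) (half hT v₀ h⁻¹)) :
    O.starLT hT g h := by
  rw [starLT_iff, rankLT, Prod.lex_def, Prod.lex_def]
  exact .inr ⟨hlen, hlt⟩

/-- If `x y` is as long as `x` and at least half of `y` is cancelled, then passing from `x` to `x y`
replaces the initial subpath `[v₀, m]` of `H(x⁻¹)` by `[v₀, y⁻¹ m]`, where `m` is the midpoint of
`[v₀, y v₀]`, and leaves `H(x)` unchanged. -/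
theorem starLT_mul_of_lt (hT : T.IsTree) {x y : T ≃g T} {m : V}
    (hxy : len v₀ (x * y) = len v₀ x) (hle : len v₀ y ≤ len v₀ x)
    (hm : T.dist v₀ (y v₀) = T.dist v₀ m + T.dist m (y v₀))
    (hm' : T.dist v₀ m = T.dist m (y v₀))
    (hlt : O.lt (treePath hT v₀ (y⁻¹ m)) (treePath hT v₀ m)) : O.starLT hT (x * y) x := by
  have hx1 : T.dist v₀ (x v₀) = T.dist (x⁻¹ v₀) v₀ := by
    rw [← x.dist_apply hT.connected (x⁻¹ v₀), RelIso.apply_inv_self]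
  have hx2 : T.dist v₀ (x m) = T.dist (x⁻¹ v₀) m := by
    rw [← x.dist_apply hT.connected (x⁻¹ v₀), RelIso.apply_inv_self]
  have hx3 : T.dist v₀ (x (y v₀)) = T.dist (x⁻¹ v₀) (y v₀) := by
    rw [← x.dist_apply hT.connected (x⁻¹ v₀), RelIso.apply_inv_self]
  have hy1 : T.dist v₀ (y⁻¹ m) = T.dist (y v₀) m := by
    rw [← y.dist_apply hT.connected v₀, RelIso.apply_inv_self]
  have hy2 : T.dist v₀ (y⁻¹ (x⁻¹ v₀)) = T.dist (y v₀) (x⁻¹ v₀) := by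
    rw [← y.dist_apply hT.connected v₀, RelIso.apply_inv_self]
  have hy3 : T.dist (y⁻¹ m) (y⁻¹ (x⁻¹ v₀)) = T.dist m (x⁻¹ v₀) := y⁻¹.dist_apply hT.connected _ _
  have h1 := x.dist_apply hT.connected m v₀
  have h2 := x.dist_apply hT.connected m (y v₀)
  have h3 := T.dist_comm (u := v₀) (v := m)
  have h4 := T.dist_comm (u := y v₀) (v := m)
  have h5 := T.dist_comm (u := y v₀) (v := x⁻¹ v₀)
  have h6 := T.dist_comm (u := m) (v := x⁻¹ v₀)
  have h7 := T.dist_comm (u := v₀) (v := x⁻¹ v₀)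
  have hxy' := hxy
  have hle' := hle
  simp only [len, RelIso.mul_apply] at hxy' hle'
  -- Since `x⁻¹ v₀` is equidistant from `v₀` and `y v₀`, the midpoint `m` lies on the geodesics from
  -- `x⁻¹ v₀` to both.
  have hor := hT.dist_eq_add_or (x⁻¹ v₀) hm
  have hinv : len v₀ (x * y)⁻¹ = len v₀ x⁻¹ := by
    rw [len_inv hT.connected, len_inv hT.connected, hxy]
  -- The common vertex `x m` is at distance `|x| - |y| / 2` from `v₀`, which is at least `|x| / 2`
  -- as `|y| ≤ |x|`.
  have hhalf : half hT v₀ (x * y) = half hT v₀ x := by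
    refine half_eq_half hT (p := x m) hxy ?_ ?_ ?_
    · rw [RelIso.mul_apply]; omega
    · omega
    · rw [len, RelIso.mul_apply]; omega
  refine O.starLT_of_pairLT hT hxy ?_
  rw [hhalf]
  refine O.pairLT_of_lt (O.lt_of_take _ _ (T.dist v₀ m) ?_ ?_)
  · rw [half_length, half_length, hinv]
  · rw [half_take hT (p := y⁻¹ m), half_take hT (p := m)]
    · exact hlt
    · rfl
    · omega
    · rw [len]; omega
    · omega
    · rw [mul_inv_rev, RelIso.mul_apply]; omega
    · rw [hinv, len]; omega

end PathOrder

end TreeAut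

/-! ### N-reduced sets are free bases of purely hyperbolic groups -/

namespace TreeAut

variable {V : Type*} {T : SimpleGraph V} {v₀ : V}

theorem mem_pm_inv {A : Type*} [Group A] {X : Set A} {x : A} (hx : x ∈ pm X) : x⁻¹ ∈ pm X := by
  rw [pm, Set.mem_ofPred_eq, inv_inv]
  exact hx.symm

/-- The four point condition for lengths of products. -/
theorem len_four_point (hT : T.IsTree) (x y z : T ≃g T) :
    len v₀ (x * y) + len v₀ (y * z) ≤
        max (len v₀ x + len v₀ z) (len v₀ (x * y * z) + len v₀ y) ∧
    len v₀ (x * y * z) + len v₀ y ≤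
        max (len v₀ x + len v₀ z) (len v₀ (x * y) + len v₀ (y * z)) := by
  have h1 : len v₀ (x * y) = T.dist (x⁻¹ v₀) (y v₀) := len_mul hT.connected x y
  have h2 : len v₀ (y * z) = T.dist v₀ (y (z v₀)) := rfl
  have h3 : len v₀ (x * y * z) = T.dist (x⁻¹ v₀) (y (z v₀)) := by
    rw [mul_assoc, len_mul hT.connected, RelIso.mul_apply]
  have h4 : len v₀ x = T.dist (x⁻¹ v₀) v₀ := by
    rw [← len_inv hT.connected, len, SimpleGraph.dist_comm]
  have h5 : len v₀ z = T.dist (y v₀) (y (z v₀)) := by rw [y.dist_apply hT.connected, len]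
  have h6 : len v₀ y = T.dist v₀ (y v₀) := rfl
  -- The four points are `x⁻¹ v₀`, `v₀`, `y v₀` and `y z v₀`.
  have h7 := hT.four_point (x⁻¹ v₀) v₀ (y v₀) (y (z v₀))
  have h8 := hT.four_point (x⁻¹ v₀) v₀ (y (z v₀)) (y v₀)
  have h9 := T.dist_comm (u := y v₀) (v := y (z v₀))
  omega

/-- The value in `A` of a letter of a word over `X`. -/
def letter {A : Type*} [Group A] {X : Set A} (a : X × Bool) : A :=
  bif a.2 then a.1 else (a.1 : A)⁻¹

theorem letter_mem_pm {A : Type*} [Group A] {X : Set A} (a : X × Bool) : letter a ∈ pm X := by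
  obtain ⟨⟨x, hx⟩, b⟩ := a
  cases b
  · exact .inr (by simpa [letter] using hx)
  · exact .inl hx

namespace NReduced

variable {X : Set (T ≃g T)}

theorem ne_one (h : NReduced v₀ X) {x : T ≃g T} (hx : x ∈ pm X) : x ≠ 1 := by
  rintro rfl
  have h1 : (1 : T ≃g T) ∈ X := hx.elim id (by simp)
  exact h.n1 1 h1 (by simpa using h1)

theorem len_pos (hT : T.Connected) (h : NReduced v₀ X) {x : T ≃g T} (hx : x ∈ pm X) :
    0 < len v₀ x := by
  have key : ∀ x ∈ X, 0 < len v₀ x := fun x hx => Nat.pos_of_ne_zero fun h0 =>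
    h.ne_one (.inl hx) (h.no_elliptic x hx (isElliptic_of_len_eq_zero hT h0))
  rcases hx with hx | hx
  · exact key x hx
  · rw [← len_inv hT]
    exact key _ hx

/-- This is (N3) as a bound on cancellation: `x` and `z` together cancel less than all of `y`. -/
theorem len_add_len_lt (hT : T.IsTree) (h : NReduced v₀ X) {x y z : T ≃g T} (hx : x ∈ pm X)
    (hy : y ∈ pm X) (hz : z ∈ pm X) (hxy : x ≠ y⁻¹) (hyz : y ≠ z⁻¹) :
    len v₀ x + len v₀ z < len v₀ (x * y) + len v₀ (y * z) := by
  have h1 := h.n3 x hx y hy z hz hxy hyz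
  have h2 := len_four_point (v₀ := v₀) hT x y z
  omega

theorem letter_ne_inv (h : NReduced v₀ X) {a b : X × Bool} (hab : a.1 = b.1 → a.2 = b.2) :
    letter a ≠ (letter b)⁻¹ := by
  obtain ⟨⟨x, hx⟩, i⟩ := a
  obtain ⟨⟨y, hy⟩, j⟩ := b
  have key : ∀ x ∈ X, ∀ y ∈ X, x ≠ y⁻¹ := by
    rintro _ hx y hy rfl
    exact h.n1 y hy hx
  simp only [Subtype.mk.injEq] at hab
  cases i <;> cases j <;> simp only [letter, cond_false, cond_true, inv_inv, ne_eq]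
  · rw [inv_eq_iff_eq_inv]
    exact key x hx y hy
  · intro hxy
    simpa using hab (inv_injective hxy)
  · intro hxy
    simpa using hab hxy
  · exact key x hx y hy

/-- Of the three sums in the four point condition, the two largest agree. The induction hypothesis
carries the strict inequality for three letters over to the whole tail, so the sum without the
middle letter is not among the largest. -/
theorem len_prod_cons_cons (hT : T.IsTree) (h : NReduced v₀ X) (L : List (X × Bool)) :
    ∀ a b : X × Bool, FreeGroup.IsReduced (a :: b :: L) →
      len v₀ (letter a * (letter b * (L.map letter).prod)) + len v₀ (letter b) =
        len v₀ (letter a * letter b) + len v₀ (letter b * (L.map letter).prod) := by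
  induction L with
  | nil => simp
  | cons c L ih =>
    intro a b hL
    rw [FreeGroup.isReduced_cons_cons] at hL
    have h1 := ih b c hL.2
    have hL' := FreeGroup.isReduced_cons_cons.1 hL.2
    have h2 := h.len_add_len_lt hT (letter_mem_pm a) (letter_mem_pm b) (letter_mem_pm c)
      (h.letter_ne_inv hL.1) (h.letter_ne_inv hL'.1)
    simp only [List.map_cons, List.prod_cons]
    have h3 := len_four_point (v₀ := v₀) hT (letter a) (letter b)
      (letter c * (L.map letter).prod)
    simp only [mul_assoc] at h3
    omega

/-- The length telescopes to the lengths of adjacent pairs minus those of the inner letters. After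
doubling, `len_add_len_lt` yields a gain of at least `1` for each further letter. -/
theorem le_len_prod_cons_cons (hT : T.IsTree) (h : NReduced v₀ X) (L : List (X × Bool)) :
    ∀ a b : X × Bool, FreeGroup.IsReduced (a :: b :: L) →
      len v₀ (letter a * letter b) + len v₀ (letter a) + L.length ≤
        2 * len v₀ (letter a * (letter b * (L.map letter).prod)) + len v₀ (letter b) := by
  induction L with
  | nil =>
    intro a b hL
    rw [FreeGroup.isReduced_cons_cons] at hL
    have := h.n2 _ (letter_mem_pm a) _ (letter_mem_pm b) (h.letter_ne_inv hL.1)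
    simp only [List.map_nil, List.prod_nil, mul_one, List.length_nil]
    omega
  | cons c L ih =>
    intro a b hL
    have h3 := h.len_prod_cons_cons hT _ a b hL
    rw [FreeGroup.isReduced_cons_cons] at hL
    have h1 := ih b c hL.2
    have hL' := FreeGroup.isReduced_cons_cons.1 hL.2
    have h2 := h.len_add_len_lt hT (letter_mem_pm a) (letter_mem_pm b) (letter_mem_pm c)
      (h.letter_ne_inv hL.1) (h.letter_ne_inv hL'.1)
    simp only [List.map_cons, List.prod_cons, List.length_cons] at h3 ⊢
    omega

theorem length_le_len_prod (hT : T.IsTree) (h : NReduced v₀ X) {L : List (X × Bool)}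
    (hL : FreeGroup.IsReduced L) (hL' : L ≠ []) :
    L.length ≤ 2 * len v₀ (L.map letter).prod + 1 ∧ 0 < len v₀ (L.map letter).prod := by
  match L with
  | [] => exact absurd rfl hL'
  | [a] =>
    have := h.len_pos hT.connected (letter_mem_pm a)
    simp [this]
  | a :: b :: L =>
    have h1 := h.le_len_prod_cons_cons hT L a b hL
    rw [FreeGroup.isReduced_cons_cons] at hL
    have h2 := h.n2 _ (letter_mem_pm a) _ (letter_mem_pm b) (h.letter_ne_inv hL.1)
    have h3 := h.len_pos hT.connected (letter_mem_pm a)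
    simp only [List.map_cons, List.prod_cons, List.length_cons]
    omega

theorem norm_le_len_lift (hT : T.IsTree) (h : NReduced v₀ X) [DecidableEq X] {w : FreeGroup X}
    (hw : w ≠ 1) :
    w.norm ≤ 2 * len v₀ (FreeGroup.lift (fun x : X => (x : T ≃g T)) w) + 1 ∧
      0 < len v₀ (FreeGroup.lift (fun x : X => (x : T ≃g T)) w) := by
  have h1 : FreeGroup.lift (fun x : X => (x : T ≃g T)) w = (w.toWord.map letter).prod := by
    conv_lhs => rw [← w.mk_toWord]
    rw [FreeGroup.lift_mk]
    rfl
  rw [h1]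
  exact h.length_le_len_prod hT FreeGroup.isReduced_toWord (by simpa using hw)

theorem lift_injective (hT : T.IsTree) (h : NReduced v₀ X) :
    Function.Injective (FreeGroup.lift fun x : X => (x : T ≃g T)) := by
  classical
  rw [injective_iff_map_eq_one]
  intro w hw
  by_contra hne
  have := (h.norm_le_len_lift hT hne).2
  rw [hw] at this
  simp [len] at this

theorem isFreeBasis (hT : T.IsTree) (h : NReduced v₀ X) : IsFreeBasis X (Subgroup.closure X) := by
  have hr : (FreeGroup.lift fun x : X => (x : T ≃g T)).range = Subgroup.closure X := by
    rw [FreeGroup.range_lift_eq_closure, Subtype.range_coe]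
  let e : FreeGroup X ≃* Subgroup.closure X :=
    (MonoidHom.ofInjective (h.lift_injective hT)).trans (MulEquiv.subgroupCongr hr)
  refine ⟨⟨e.symm⟩, fun x => ?_⟩
  change ((e (FreeGroup.of x) : Subgroup.closure X) : T ≃g T) = x
  exact FreeGroup.lift_apply_of

/-- The powers of a non-trivial element have unbounded lengths, those of an element that fixes a
vertex or inverts an edge do not. -/
theorem purelyHyperbolic (hT : T.IsTree) (h : NReduced v₀ X) (hX : X.Finite) :
    PurelyHyperbolic (Subgroup.closure X) := by
  classical
  have key : ∀ g ∈ Subgroup.closure X, g ≠ 1 → ∀ C, ∃ k : ℕ, C < len v₀ (g ^ k) := by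
    intro g hg hg1 C
    have hr : (FreeGroup.lift fun x : X => (x : T ≃g T)).range = Subgroup.closure X := by
      rw [FreeGroup.range_lift_eq_closure, Subtype.range_coe]
    obtain ⟨w, rfl⟩ := hr.symm ▸ hg
    by_contra! hC
    have hw : w ≠ 1 := by
      rintro rfl
      exact hg1 (map_one _)
    have := hX.to_subtype
    have hfin : {u : FreeGroup X | u.norm ≤ 2 * C + 1}.Finite :=
      (List.finite_length_le (X × Bool) (2 * C + 1)).preimage FreeGroup.toWord_injective.injOn
    -- Free groups are torsion-free, so the powers of `w` are distinct, while only finitely many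
    -- words over the finite set `X` have bounded norm.
    refine Set.infinite_of_injective_forall_mem (f := fun k : ℕ => w ^ k)
      (IsMulTorsionFree.pow_right_injective hw) (fun k => ?_) hfin
    by_cases hk : w ^ k = 1
    · simp [hk]
    · have h1 := (h.norm_le_len_lift hT hk).1
      have h2 := hC k
      rw [← map_pow] at h2
      rw [Set.mem_ofPred_eq]
      omega
  have bound : ∀ g : T ≃g T, ∀ u, ∀ C, (∀ k : ℕ, T.dist u ((g ^ k) u) ≤ C) →
      ∀ k : ℕ, len v₀ (g ^ k) ≤ 2 * T.dist v₀ u + C := by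
    intro g u C hC k
    have h1 := hC k
    have h2 := (g ^ k).dist_apply hT.connected u v₀
    have h3 := hT.connected.dist_triangle (u := v₀) (v := u) (w := (g ^ k) v₀)
    have h4 := hT.connected.dist_triangle (u := u) (v := (g ^ k) u) (w := (g ^ k) v₀)
    have h5 := T.dist_comm (u := v₀) (v := u)
    rw [len]
    omega
  intro g hg hg1
  refine isHyperbolic_of_forall hT.connected (fun u hu => ?_) (fun u hadj hu => ?_)
  · obtain ⟨k, hk⟩ := key g hg hg1 (2 * T.dist v₀ u + 0)
    refine absurd (bound g u 0 (fun k => ?_) k) (not_le.2 hk)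
    have : (g ^ k) u = u := by
      induction k with
      | zero => rfl
      | succ k ih => rw [pow_succ, RelIso.mul_apply, hu, ih]
    simp [this]
  · obtain ⟨k, hk⟩ := key g hg hg1 (2 * T.dist v₀ u + 1)
    refine absurd (bound g u 1 (fun k => ?_) k) (not_le.2 hk)
    have : (g ^ k) u = u ∨ (g ^ k) u = g u := by
      induction k with
      | zero => exact .inl rfl
      | succ k ih =>
        rw [pow_succ', RelIso.mul_apply]
        rcases ih with ih | ih
        · exact .inr (by rw [ih])
        · exact .inl (by rw [ih, hu])
    rcases this with h | h
    · simp [h]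
    · rw [h, SimpleGraph.dist_eq_one_iff_adj.2 hadj]

end NReduced

end TreeAut

/-! ### The reduction algorithm -/

namespace TreeAut

/-! ### Nielsen operations preserve the generated subgroup and finiteness. -/

section Nielsen

variable {A : Type*} [Group A] {X Y : Set A}

theorem closure_diff_union_eq {g k : A} (hk : k ∈ Subgroup.closure X)
    (hg : g ∈ Subgroup.closure (X \ {g} ∪ {k})) :
    Subgroup.closure (X \ {g} ∪ {k}) = Subgroup.closure X := by
  refine le_antisymm ?_ ?_ <;> rw [Subgroup.closure_le]
  · rintro x (hx | rfl)
    · exact Subgroup.subset_closure hx.1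
    · exact hk
  · intro x hx
    by_cases hxg : x = g
    · exact hxg ▸ hg
    · exact Subgroup.subset_closure (.inl ⟨hx, hxg⟩)

theorem NielsenOp.closure_eq (h : NielsenOp X Y) : Subgroup.closure Y = Subgroup.closure X := by
  have sub : ∀ {Z : Set A} {x}, x ∈ Z → x ∈ Subgroup.closure Z :=
    fun hx => Subgroup.subset_closure hx
  have of_inv : ∀ {H : Subgroup A} {a b : A}, (b = a ∨ b = a⁻¹) → (b ∈ H ↔ a ∈ H) := by
    rintro H a b (rfl | rfl)
    · rfl
    · exact inv_mem_iff
  cases h with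
  | @remove g hg hg' h =>
    refine le_antisymm (Subgroup.closure_mono Set.sdiff_subset) ?_
    rw [Subgroup.closure_le]
    intro x hx
    by_cases hxg : x = g
    · subst hxg
      by_cases hx1 : x = x⁻¹
      · rw [h hx1]
        exact one_mem _
      · exact inv_mem_iff.1 (sub ⟨hg', fun h => hx1 h.symm⟩)
    · exact sub ⟨hx, hxg⟩
  | @invert g hg =>
    exact closure_diff_union_eq (inv_mem (sub hg)) (inv_mem_iff.1 (sub (.inr rfl)))
  | @mul_right g h g' h' hg hh hne hg' hh' =>
    refine closure_diff_union_eq (mul_mem ((of_inv hg').2 (sub hg)) ((of_inv hh').2 (sub hh))) ?_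
    rw [← of_inv hg', ← mul_mem_cancel_right ((of_inv hh').2 (sub (.inl ⟨hh, hne⟩)))]
    exact sub (.inr rfl)
  | @mul_left g h g' h' hg hh hne hg' hh' =>
    refine closure_diff_union_eq (mul_mem ((of_inv hh').2 (sub hh)) ((of_inv hg').2 (sub hg))) ?_
    rw [← of_inv hg', ← mul_mem_cancel_left ((of_inv hh').2 (sub (.inl ⟨hh, hne⟩)))]
    exact sub (.inr rfl)

theorem NielsenOp.finite (h : NielsenOp X Y) (hX : X.Finite) : Y.Finite := by
  cases h with
  | remove => exact hX.sdiff
  | invert => exact hX.sdiff.union (Set.finite_singleton _)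
  | mul_right => exact hX.sdiff.union (Set.finite_singleton _)
  | mul_left => exact hX.sdiff.union (Set.finite_singleton _)

theorem NielsenTransforms.closure_eq (h : NielsenTransforms X Y) :
    Subgroup.closure Y = Subgroup.closure X := by
  induction h with
  | refl => rfl
  | tail _ h ih => rw [h.closure_eq, ih]

theorem NielsenTransforms.finite (h : NielsenTransforms X Y) (hX : X.Finite) : Y.Finite := by
  induction h with
  | refl => exact hX
  | tail _ h ih => exact h.finite ih

theorem exists_mem_of_mem_pm {x : A} (hx : x ∈ pm X) : ∃ g ∈ X, x = g ∨ x = g⁻¹ := by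
  rcases hx with hx | hx
  · exact ⟨x, hx, .inl rfl⟩
  · exact ⟨x⁻¹, hx, .inr (inv_inv x).symm⟩

end Nielsen

variable {V : Type*} {T : SimpleGraph V} {v₀ : V} {hT : T.IsTree} {O : PathOrder T v₀}
  {X Y : Set (T ≃g T)}

theorem len_le_of_starLT {g h : T ≃g T} (hlt : O.starLT hT g h) : len v₀ g ≤ len v₀ h :=
  hlt.1.elim le_of_lt fun h => h.1.le

/-- The identity is its own inverse, so the second test excludes it and the first then excludes
every elliptic element. -/
theorem exists_not_isElliptic_of_mem_pm (h₁ : ¬ HasElliptic X) (h₂ : ¬ HasInversePair X) {x : T ≃g T}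
    (hx : x ∈ pm X) : ∃ g ∈ X, (x = g ∨ x = g⁻¹) ∧ ¬ IsElliptic g := by
  obtain ⟨g, hg, hxg⟩ := exists_mem_of_mem_pm hx
  refine ⟨g, hg, hxg, fun hell => h₁ ⟨g, hg, ?_, hell⟩⟩
  rintro rfl
  exact h₂ ⟨1, hg, by simpa using hg⟩

theorem diff_pair_eq (h₂ : ¬ HasInversePair X) {g x : T ≃g T} (hg : g ∈ X)
    (hxg : x = g ∨ x = g⁻¹) : X \ {x, x⁻¹} = X \ {g} := by
  ext z
  have key : z ∈ X → z ≠ g⁻¹ := by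
    rintro hz rfl
    exact h₂ ⟨g, hg, hz⟩
  rcases hxg with rfl | rfl <;> simp <;> tauto

/-- Rewrites a reduction in terms of the stored elements `g` and `k` underlying `x` and `y`. If they
coincided, `y = x` and `|x²| ≤ |x|` would make `g` elliptic. -/
theorem Reduces.exists_mem (h₁ : ¬ HasElliptic X) (h₂ : ¬ HasInversePair X) {x y : T ≃g T}
    (h : Reduces hT O X x y) : ∃ g ∈ X, (x = g ∨ x = g⁻¹) ∧ X \ {x, x⁻¹} = X \ {g} ∧
      O.starLT hT (x * y) g ∧ ∃ k ∈ X, (y = k ∨ y = k⁻¹) ∧ k ≠ g := by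
  obtain ⟨hx, hy, hne, hlt⟩ := h
  obtain ⟨g, hg, hxg, hell⟩ := exists_not_isElliptic_of_mem_pm h₁ h₂ hx
  obtain ⟨k, hk, hyk⟩ := exists_mem_of_mem_pm hy
  refine ⟨g, hg, hxg, diff_pair_eq h₂ hg hxg, ?_, k, hk, hyk, ?_⟩
  · rcases hxg with rfl | rfl
    · exact hlt
    · rwa [O.starLT_iff, O.rank_inv, ← O.starLT_iff] at hlt
  · rintro rfl
    refine hell (isElliptic_of_len_sq_le (v₀ := v₀) hT ?_)
    have hle := len_le_of_starLT hlt
    rcases hxg with rfl | rfl <;> rcases hyk with rfl | rfl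
    · exact hle
    · simp at hne
    · simp at hne
    · rwa [← mul_inv_rev, len_inv hT.connected, len_inv hT.connected] at hle

theorem Step.nielsenOp (h : Step hT O (.loop X) (.loop Y)) : NielsenOp X Y := by
  cases h with
  | @cancel _ x h₁ hx hx' =>
    refine .remove hx hx' fun hinv => ?_
    by_contra hne
    -- A non-trivial involution has `|x²| = 0`, so it is elliptic and the first test would have
    -- caught it.
    refine h₁ ⟨x, hx, hne, isElliptic_of_len_sq_le (v₀ := v₀) hT ?_⟩
    nth_rewrite 1 [hinv]
    simp [len]
  | @replace _ x y h₁ h₂ h₃ =>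
    obtain ⟨g, hg, hxg, hdiff, -, k, hk, hyk, hne⟩ := h₃.exists_mem h₁ h₂
    rw [hdiff]
    exact .mul_right hg hk hne hxg hyk

theorem Returns.nielsenTransforms_and_step {flag : Bool} (h : Returns hT O X flag Y) :
    NielsenTransforms X Y ∧ Step hT O (.loop Y) (.ret flag Y) := by
  -- The invariant also remembers the halting step, whose failed or successful tests describe the
  -- returned set.
  let P : State (T ≃g T) → Prop
    | .loop Z => NielsenTransforms X Z
    | .ret f Z => NielsenTransforms X Z ∧ Step hT O (.loop Z) (.ret f Z)
  suffices ∀ s, Relation.ReflTransGen (Step hT O) (.loop X) s → P s from this _ h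
  intro s hs
  induction hs with
  | refl => exact Relation.ReflTransGen.refl
  | tail _ hstep ih =>
    cases hstep with
    | elliptic h₁ => exact ⟨ih, .elliptic h₁⟩
    | cancel h₁ hx hx' => exact Relation.ReflTransGen.tail ih (Step.cancel (hT := hT) (O := O) h₁ hx hx').nielsenOp
    | replace h₁ h₂ h₃ => exact Relation.ReflTransGen.tail ih (Step.replace (hT := hT) (O := O) h₁ h₂ h₃).nielsenOp
    | done h₁ h₂ h₃ => exact ⟨ih, .done h₁ h₂ h₃⟩

theorem acc_ret (flag : Bool) (X : Set (T ≃g T)) :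
    Acc (fun s' s => Step hT O s s') (.ret flag X) :=
  ⟨_, fun _ h => nomatch h⟩

/-! ### Termination by the multiset order. -/

theorem cutExpand_erase {α : Type*} [DecidableEq α] {r : α → α → Prop} {F : Finset α} {a : α}
    (ha : a ∈ F) : Relation.CutExpand r (F.erase a).val F.val := by
  refine ⟨0, a, by simp, ?_⟩
  rw [Finset.erase_val, add_zero, add_comm, Multiset.singleton_add, Multiset.cons_erase ha]

theorem cutExpand_insert_erase {α : Type*} [DecidableEq α] {r : α → α → Prop} {F : Finset α}
    {a b : α} (ha : a ∈ F) (hb : r b a) :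
    Relation.CutExpand r (insert b (F.erase a)).val F.val := by
  -- If the new element is already present, the set merely loses `a`.
  by_cases h : b ∈ F.erase a
  · rw [Finset.insert_eq_of_mem h]
    exact cutExpand_erase ha
  · refine ⟨{b}, a, by simpa using hb, ?_⟩
    rw [Finset.insert_val_of_notMem h, Finset.erase_val, add_comm, Multiset.singleton_add,
      Multiset.cons_swap, Multiset.cons_erase ha, add_comm, Multiset.singleton_add]

theorem terminates (hX : X.Finite) : Terminates hT O X := by
  classical
  have hwf : WellFounded (O.starLT hT) := (O.isPreWellOrdering_starLE hT).wf
  suffices ∀ F : Finset (T ≃g T), Terminates hT O F by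
    simpa using this hX.toFinset
  intro F
  induction F using (InvImage.wf Finset.val hwf.cutExpand).induction with
  | _ F ih =>
    refine ⟨_, fun s hs => ?_⟩
    cases hs with
    | elliptic => exact acc_ret _ _
    | done => exact acc_ret _ _
    | @cancel _ x h₁ hx hx' =>
      have := ih (F.erase x) (cutExpand_erase hx)
      rwa [Finset.coe_erase] at this
    | @replace _ x y h₁ h₂ h₃ =>
      obtain ⟨g, hg, -, hdiff, hlt, -⟩ := h₃.exists_mem h₁ h₂
      have := ih (insert (x * y) (F.erase g)) (cutExpand_insert_erase hg hlt)
      rwa [Finset.coe_insert, Finset.coe_erase, ← hdiff, ← Set.union_singleton] at this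

theorem exists_returns (h : Terminates hT O X) : ∃ flag X', Returns hT O X flag X' := by
  suffices ∀ s, Acc (fun s' s => Step hT O s s') s → ∀ X, s = .loop X →
      ∃ flag X', Returns hT O X flag X' from this _ h X rfl
  intro s hs
  induction hs with
  | intro s _ ih =>
    rintro X rfl
    by_cases h₁ : HasElliptic X
    · exact ⟨_, _, .single (.elliptic h₁)⟩
    by_cases h₂ : HasInversePair X
    · obtain ⟨x, hx, hx'⟩ := h₂
      have hstep : Step hT O _ _ := .cancel h₁ hx hx'
      obtain ⟨flag, X', h⟩ := ih _ hstep _ rfl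
      exact ⟨flag, X', .head hstep h⟩
    by_cases h₃ : ∃ x y, Reduces hT O X x y
    · obtain ⟨x, y, h₃⟩ := h₃
      have hstep : Step hT O _ _ := .replace h₁ h₂ h₃
      obtain ⟨flag, X', h⟩ := ih _ hstep _ rfl
      exact ⟨flag, X', .head hstep h⟩
    · exact ⟨_, _, .single (.done h₁ h₂ h₃)⟩

/-- A set to which no test of the algorithm applies is N-reduced. -/
theorem nReduced_of_not_reduces (h₁ : ¬ HasElliptic X) (h₂ : ¬ HasInversePair X)
    (h₃ : ¬ ∃ x y, Reduces hT O X x y) : NReduced v₀ X := by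
  have hred : ∀ x ∈ pm X, ∀ y ∈ pm X, x ≠ y⁻¹ → ¬ O.starLT hT (x * y) x :=
    fun x hx y hy hne hlt => h₃ ⟨x, y, hx, hy, hne, hlt⟩
  have hle : ∀ x ∈ pm X, ∀ y ∈ pm X, x ≠ y⁻¹ → len v₀ x ≤ len v₀ (x * y) :=
    fun x hx y hy hne => not_lt.1 fun hlt => hred x hx y hy hne (O.starLT_of_len_lt hT hlt)
  have hle' : ∀ x ∈ pm X, ∀ y ∈ pm X, x ≠ y⁻¹ → len v₀ y ≤ len v₀ (x * y) := by
    intro x hx y hy hne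
    have := hle _ (mem_pm_inv hy) _ (mem_pm_inv hx) (by rw [inv_inv]; exact hne.symm)
    rwa [← mul_inv_rev, len_inv hT.connected, len_inv hT.connected] at this
  refine ⟨?_, fun x hx hx' => h₂ ⟨x, hx, hx'⟩, fun x hx y hy hne =>
    max_le (hle x hx y hy hne) (hle' x hx y hy hne), ?_⟩
  · intro x hx hell
    by_contra hne
    exact h₁ ⟨x, hx, hne, hell⟩
  intro x hx y hy z hz hxy hyz
  by_contra! hcon
  have h4 := len_four_point (v₀ := v₀) hT x y z
  have hx1 := hle x hx y hy hxy
  have hx2 := hle' x hx y hy hxy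
  have hz1 := hle y hy z hz hyz
  have hz2 := hle' y hy z hz hyz
  -- The failure of (N3) and the four point condition give `|xy| + |yz| ≤ |x| + |z|`; the reverse
  -- bounds hold termwise.
  have hlx : len v₀ (x * y) = len v₀ x := by omega
  have hlz : len v₀ (y * z) = len v₀ z := by omega
  -- The perimeter `2|x| + |y|` is even, so `[v₀, y v₀]` has a vertex as its midpoint.
  obtain ⟨j, hj⟩ := hT.even_dist_add_dist_add_dist (x⁻¹ v₀) v₀ (y v₀)
  rw [← len_mul hT.connected, hlx, T.dist_comm (u := x⁻¹ v₀)] at hj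
  change len v₀ x⁻¹ + len v₀ y + len v₀ x = _ at hj
  rw [len_inv hT.connected] at hj
  obtain ⟨m, hm, hm'⟩ := hT.exists_dist_eq v₀ (y v₀) (len v₀ y / 2) (Nat.div_le_self _ _)
  have hmy : T.dist v₀ (y v₀) = len v₀ y := rfl
  have hn1 := O.starLT_mul_of_lt hT (x := x) (y := y) (m := m) hlx (by omega) (by omega) (by omega)
  have hd1 : T.dist v₀ (y⁻¹ m) = T.dist m (y v₀) := by
    rw [← y.dist_apply hT.connected v₀, RelIso.apply_inv_self, T.dist_comm]
  have hd2 : T.dist (y⁻¹ m) (y⁻¹ v₀) = T.dist v₀ m := by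
    rw [y⁻¹.dist_apply hT.connected, T.dist_comm]
  have hd3 : T.dist v₀ (y⁻¹ v₀) = len v₀ y := len_inv hT.connected y
  have hn2 := O.starLT_mul_of_lt hT (x := z⁻¹) (y := y⁻¹) (m := y⁻¹ m)
    (by rw [← mul_inv_rev, len_inv hT.connected, len_inv hT.connected, hlz])
    (by rw [len_inv hT.connected, len_inv hT.connected]; omega) (by omega) (by omega)
  rw [inv_inv, RelIso.apply_inv_self] at hn2
  -- Either strict comparison of the paths to `m` and `y⁻¹ m` would permit a reduction, of `x` by
  -- `y` or of `z⁻¹` by `y⁻¹`.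
  have hfix : m = y⁻¹ m := by
    have := O.isWellOrder
    have heq := Std.Trichotomous.trichotomous (r := O.lt) _ _
      (fun h => hred _ (mem_pm_inv hz) _ (mem_pm_inv hy)
        (by rw [inv_inv]; exact hyz.symm) (hn2 h))
      (fun h => hred _ hx _ hy hxy (hn1 h))
    exact congrArg Sigma.fst heq
  have hfix' : y m = m := by
    nth_rewrite 1 [hfix]
    exact RelIso.apply_inv_self y m
  obtain ⟨g, -, hyg, hell⟩ := exists_not_isElliptic_of_mem_pm h₁ h₂ hy
  rcases hyg with rfl | rfl
  · exact hell (isElliptic_of_fixed hfix')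
  · exact hell (isElliptic_of_fixed (by rw [← inv_inv g]; exact hfix.symm))

end TreeAut

theorem theoremA {V : Type*} (T : SimpleGraph V) (hT : T.IsTree) (v₀ : V)
    (X : Set (T ≃g T)) (hX : X.Finite) :
    Nonempty (TreeAut.PathOrder T v₀) ∧
    ∀ O : TreeAut.PathOrder T v₀,
      TreeAut.IsPreWellOrdering (O.starLE hT) ∧
      TreeAut.Terminates hT O X ∧
      (∃ flag X', TreeAut.Returns hT O X flag X') ∧
      ∀ flag X', TreeAut.Returns hT O X flag X' →
        X'.Finite ∧
        Subgroup.closure X' = Subgroup.closure X ∧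
        TreeAut.NielsenTransforms X X' ∧
        (flag = false → ∃ x ∈ X', x ≠ 1 ∧ TreeAut.IsElliptic x) ∧
        (flag = true →
          TreeAut.NReduced v₀ X' ∧
          TreeAut.PurelyHyperbolic (Subgroup.closure X) ∧
          TreeAut.IsFreeBasis X' (Subgroup.closure X)) := by
  refine ⟨TreeAut.nonempty_pathOrder T v₀, fun O => ⟨O.isPreWellOrdering_starLE hT,
    TreeAut.terminates hX, TreeAut.exists_returns (TreeAut.terminates hX), ?_⟩⟩
  intro flag X' h
  obtain ⟨hN, hstep⟩ := h.nielsenTransforms_and_step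
  have hX' := hN.finite hX
  refine ⟨hX', hN.closure_eq, hN, ?_, ?_⟩
  · rintro rfl
    cases hstep with
    | elliptic h₁ => exact h₁
  · rintro rfl
    cases hstep with
    | done h₁ h₂ h₃ =>
      have hred := TreeAut.nReduced_of_not_reduces h₁ h₂ h₃
      rw [← hN.closure_eq]
      exact ⟨hred, hred.purelyHyperbolic hT hX', hred.isFreeBasis hT⟩
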